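/- Fix a partial computable machine $U$ taking an input string $y$ and a program string $P$ that is universal (every partial computable function on binary strings is $y\mapsto U(y,P)$ for some $P$) and additively optimal (for every partial computable $V$ there is a constant $c$ such that $V(y,P)=x$ implies $U(y,Q)=x$ for some $Q$ of length at most $l(P)+c$). Let $C(x)$ be the least length $l(P)$ of a program $P$ with $U(\epsilon,P)=x$, where $\epsilon$ is the empty string, and let $C(n)$ be the complexity of the $n$-th binary string in length-lexicographic order. For a real $\alpha$ let $\alpha_n$ be the string of the first $n$ binary digits of (the fractional part of) $\alpha$. A real $\alpha$ is left c.e. if it is the limit of a computable nondecreasing sequence of rationals; a program for $\alpha$ is a $P$ such that, for every $s$, $U$ with program $P$ on input $s$ outputs (a code of) the $s$-th term of some such sequence. A real is computable if its sequence of binary digits is computable, and Turing-complete if this sequence computes the halting problem. Then there is a computable function $D:\mathbb N\to\mathbb N$ such that for every non-computable, Turing-incomplete left c.e. real $\alpha$: 1. $C(\alpha_n)-C(n)$ is unbounded: for every $k$ there is an $n$ with $C(\alpha_n)>C(n)+k$; 2. there is a constant $d$, computable from the length of a program for $\alpha$, such that $C(\alpha_n)<C(n)+d$ for infinitely many $n$: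 namely, $\alpha$ has a program, and for every program $P_\alpha$ for $\alpha$ one may take $d=D(l(P_\alpha))$. -/

import Mathlib

namespace LeftCE

/-- Binary strings. -/
abbrev BinStr : Type := List Bool

/-- The standard bijection between natural numbers and binary strings: write `n + 1` in binary,
most significant bit first, and delete the leading `1`. So `0, 1, 2, 3, …` become
`ε, 0, 1, 00, …`. -/
def strOfNat (n : ℕ) : BinStr := (Nat.bits (n + 1)).dropLast.reverse

/-- `U y P` is the (possibly undefined) output of the machine `U` on input `⟨y, P⟩`, where `P` is
the program. `U` is universal if every partial computable function of strings is computed by some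
program, and additively optimal if descriptions with respect to any other machine can be replaced
by `U`-descriptions that are longer by at most a constant. -/
structure IsUniversalOptimal (U : BinStr → BinStr →. BinStr) : Prop where
  partrec : Partrec₂ U
  universal : ∀ f : BinStr →. BinStr, Partrec f → ∃ P : BinStr, ∀ y, U y P = f y
  optimal : ∀ V : BinStr → BinStr →. BinStr, Partrec₂ V →
    ∃ c : ℕ, ∀ x y P, x ∈ V y P → ∃ Q : BinStr, Q.length ≤ P.length + c ∧ x ∈ U y Q

/-- Conditional Kolmogorov complexity `C(x | y)` with respect to `U`: the least length of a
program that outputs `x` on input `y`. -/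
noncomputable def condC (U : BinStr → BinStr →. BinStr) (x y : BinStr) : ℕ :=
  sInf {l : ℕ | ∃ P : BinStr, P.length = l ∧ x ∈ U y P}

/-- Kolmogorov complexity `C(x) = C(x | ε)` of a string. -/
noncomputable def C (U : BinStr → BinStr →. BinStr) (x : BinStr) : ℕ := condC U x []

/-- Kolmogorov complexity `C(n)` of a natural number. -/
noncomputable def CNat (U : BinStr → BinStr →. BinStr) (n : ℕ) : ℕ := C U (strOfNat n)

/-- The `i`-th binary digit (counted from `0`) of the real `α` after the binary point. -/
noncomputable def bit (α : ℝ) (i : ℕ) : Bool := decide (Real.digits (Int.fract α) 2 i = 1)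

/-- `α_n`: the string of the first `n` binary digits of `α`. -/
noncomputable def initSeg (α : ℝ) (n : ℕ) : BinStr := (List.range n).map (bit α)

/-- The rational coded by a natural number: the code `⟨⟨a, b⟩, c⟩` stands for
`(a - b) / (c + 1)`. Every rational has a code. -/
def ratOfNat (m : ℕ) : ℚ :=
  ((m.unpair.1.unpair.1 : ℚ) - (m.unpair.1.unpair.2 : ℚ)) / ((m.unpair.2 : ℚ) + 1)

/-- `q` lists (codes of) a nondecreasing sequence of rationals with limit `α`. -/
def ApproximatesFromBelow (q : ℕ → ℕ) (α : ℝ) : Prop :=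
  Monotone (fun s => ratOfNat (q s)) ∧
    Filter.Tendsto (fun s => ((ratOfNat (q s) : ℚ) : ℝ)) Filter.atTop (nhds α)

/-- `α` is a left c.e. real: the limit of a computable nondecreasing sequence of rationals. -/
def IsLeftCE (α : ℝ) : Prop :=
  ∃ q : ℕ → ℕ, Computable q ∧ ApproximatesFromBelow q α

/-- `P` is a `U`-program that enumerates a nondecreasing sequence of rationals with limit `α`:
on input `s` it outputs the `s`-th rational. -/
def Enumerates (U : BinStr → BinStr →. BinStr) (P : BinStr) (α : ℝ) : Prop :=
  ∃ q : ℕ → ℕ, (∀ s, strOfNat (q s) ∈ U (strOfNat s) P) ∧ ApproximatesFromBelow q α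

/-- `α` is computable: its sequence of binary digits is. -/
def IsComputableReal (α : ℝ) : Prop := Computable (bit α)

/-- The binary digits of `α` as an oracle. -/
noncomputable def oracle (α : ℝ) : ℕ →. ℕ := fun i => Part.some (bit α i).toNat

open Classical in
/-- The characteristic function of the halting problem: does the `e`-th program halt on
input `e`? -/
noncomputable def haltingChar : ℕ →. ℕ := fun e =>
  Part.some (if ((Denumerable.ofNat Nat.Partrec.Code e).eval e).Dom then 1 else 0)

/-- `α` is Turing-complete: the halting problem is Turing-reducible to `α`. -/
def IsTuringComplete (α : ℝ) : Prop := TuringReducible haltingChar (oracle α)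

end LeftCE

/-!
Every `m` has a number `n` with `m ≤ C(n)` whose string has length `m`. For such an `n` only
boundedly many strings of length `n` have complexity at most `m + O(1)`: numbers `n` with many such
strings are so rare that their index in an enumeration describes them with fewer than `m` bits.
Hence, if `C(α_n) - C(n)` is bounded, then the initial segments of `α` lie in a computably
enumerable family with boundedly many candidates of each length, and this makes `α` computable.

If `α` is Turing-incomplete, then for infinitely many `n` the `n`-th program halts on input `n`,
and it does so only after the approximation of `α` from below has settled on the first `n` digits:
otherwise the stage at which the digits settle, which `α` computes, would decide the halting
problem. For these `n`, a program for `α` and a program for `n` together give `α_n`: run the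
approximation for as many steps as the `n`-th program takes to halt.
-/

namespace LeftCE

/-! ### Computability -/

section Computability

variable {β σ : Type*} [Primcodable β] [Primcodable σ]

theorem primrec_pow : Primrec₂ fun a b : ℕ => a ^ b :=
  Primrec₂.unpaired'.1 Nat.Primrec.pow

theorem primrecRel_mem : PrimrecRel fun (a : σ) (l : List σ) => a ∈ l :=
  ((PrimrecRel.exists_mem_list (R := fun b a : σ => b = a) Primrec.eq).of_eq
    fun l a => by simp).swap

theorem primrec_list_dedup [DecidableEq σ] : Primrec (List.dedup : List σ → List σ) := by
  refine (Primrec.list_foldr (f := fun l : List σ => l) (g := fun _ => ([] : List σ))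
    (h := fun _ x => if x.1 ∈ x.2 then x.2 else x.1 :: x.2)
    Primrec.id (Primrec.const []) ?_).of_eq fun l => ?_
  · exact Primrec.ite
      (primrecRel_mem.comp (Primrec.fst.comp Primrec.snd) (Primrec.snd.comp Primrec.snd))
      (Primrec.snd.comp Primrec.snd) (Primrec.list_cons.comp (Primrec.fst.comp Primrec.snd)
        (Primrec.snd.comp Primrec.snd))
  · induction l with
    | nil => rfl
    | cons a l ih =>
      simp only [List.foldr_cons] at ih ⊢
      rw [ih]
      by_cases ha : a ∈ l
      · rw [if_pos (List.mem_dedup.2 ha), List.dedup_cons_of_mem ha]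
      · rw [if_neg (mt List.mem_dedup.1 ha), List.dedup_cons_of_notMem ha]

theorem primrec_card_toFinset [DecidableEq σ] : Primrec fun l : List σ => l.toFinset.card :=
  (Primrec.list_length.comp primrec_list_dedup).of_eq fun l => (List.card_toFinset l).symm

theorem computablePred_comp {p : β → Prop} (hp : PrimrecPred p) {f : σ → β} (hf : Computable f) :
    ComputablePred fun a => p (f a) := by
  classical
  exact ⟨inferInstance, hp.decide.to_comp.comp hf⟩

theorem exists_computable_choice {P : β → ℕ → Prop}
    (hP : ComputablePred fun p : β × ℕ => P p.1 p.2) (h : ∀ a, ∃ n, P a n) :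
    ∃ f : β → ℕ, Computable f ∧ ∀ a, P a (f a) := by
  classical
  exact ⟨_, Computable.find hP h, fun a => Nat.find_spec (h a)⟩

theorem exists_primrec_stages {f : β →. σ} (hf : Partrec f) :
    ∃ u : ℕ → β → Option σ, Primrec₂ u ∧
      (∀ s t a x, s ≤ t → u s a = some x → u t a = some x) ∧
      ∀ a x, x ∈ f a ↔ ∃ t, u t a = some x := by
  obtain ⟨c, hc⟩ := Nat.Partrec.Code.exists_code.1 hf
  have hmem : ∀ a y, y ∈ c.eval (Encodable.encode a) ↔ ∃ x ∈ f a, Encodable.encode x = y := by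
    simp [hc]
  refine ⟨fun t a => (c.evaln t (Encodable.encode a)).bind Encodable.decode, ?_, ?_, ?_⟩
  · exact Primrec.option_bind (Nat.Partrec.Code.primrec_evaln.comp ((Primrec.fst.pair
      (Primrec.const c)).pair (Primrec.encode.comp Primrec.snd)))
        (Primrec.decode.comp Primrec.snd)
  · intro s t a x hst h
    obtain ⟨y, hy, hyx⟩ := Option.bind_eq_some_iff.1 h
    exact Option.bind_eq_some_iff.2 ⟨y, Nat.Partrec.Code.evaln_mono hst hy, hyx⟩
  · refine fun a x => ⟨fun hx => ?_, ?_⟩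
    · obtain ⟨t, ht⟩ := Nat.Partrec.Code.evaln_complete.1 ((hmem a _).2 ⟨x, hx, rfl⟩)
      exact ⟨t, Option.bind_eq_some_iff.2 ⟨_, ht, Encodable.encodek x⟩⟩
    · rintro ⟨t, ht⟩
      obtain ⟨y, hy, hyx⟩ := Option.bind_eq_some_iff.1 ht
      obtain ⟨x', hx', rfl⟩ := (hmem a y).1 (Nat.Partrec.Code.evaln_sound hy)
      rw [Encodable.encodek, Option.some_inj] at hyx
      exact hyx ▸ hx'

end Computability

/-! ### The numbering of binary strings -/

/-- The position of a string in the length-lexicographic order, the inverse of `strOfNat`. -/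
def natOfStr (l : BinStr) : ℕ := l.foldl (fun n b => 2 * n + 1 + b.toNat) 0

theorem natOfStr_append_singleton (l : BinStr) (b : Bool) :
    natOfStr (l ++ [b]) = 2 * natOfStr l + 1 + b.toNat := by
  simp [natOfStr]

@[simp]
theorem strOfNat_zero : strOfNat 0 = [] := by simp [strOfNat]

theorem strOfNat_two_mul_add (n : ℕ) (b : Bool) :
    strOfNat (2 * n + 1 + b.toNat) = strOfNat n ++ [b] := by
  have hbit : 2 * n + 1 + b.toNat + 1 = Nat.bit b (n + 1) := by
    cases b <;> simp [Nat.bit] <;> omega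
  have hne : (n + 1).bits ≠ [] := by
    rw [← List.length_pos_iff, Nat.size_eq_bits_len]
    exact Nat.size_pos.2 n.succ_pos
  rw [strOfNat, hbit, Nat.bits_append_bit _ _ (by simp), List.dropLast_cons_of_ne_nil hne,
    List.reverse_cons, strOfNat]

theorem succ_eq_two_mul_half_add (n : ℕ) :
    n + 1 = 2 * (n / 2) + 1 + (decide (n % 2 = 1)).toNat := by
  rcases Nat.mod_two_eq_zero_or_one n with h | h <;> simp [h] <;> omega

@[simp]
theorem strOfNat_natOfStr (l : BinStr) : strOfNat (natOfStr l) = l := by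
  induction l using List.reverseRecOn with
  | nil => exact strOfNat_zero
  | append_singleton l b ih => rw [natOfStr_append_singleton, strOfNat_two_mul_add, ih]

@[simp]
theorem natOfStr_strOfNat (n : ℕ) : natOfStr (strOfNat n) = n := by
  induction n using Nat.strong_induction_on with
  | _ n ih =>
    rcases n with _ | n
    · rw [strOfNat_zero]; rfl
    · rw [succ_eq_two_mul_half_add, strOfNat_two_mul_add, natOfStr_append_singleton,
        ih _ (by omega)]

theorem strOfNat_injective : Function.Injective strOfNat :=
  Function.LeftInverse.injective natOfStr_strOfNat

theorem primrec_natOfStr : Primrec natOfStr :=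
  Primrec.list_foldl Primrec.id (Primrec.const 0)
    (h := fun _ (x : ℕ × Bool) => 2 * x.1 + 1 + x.2.toNat) <|
      Primrec.nat_add.comp (Primrec.nat_double_succ.comp (Primrec.fst.comp Primrec.snd))
        ((Primrec.dom_bool Bool.toNat).comp (Primrec.snd.comp Primrec.snd))

theorem primrec_strOfNat : Primrec strOfNat := by
  let next : List BinStr → Option BinStr := fun l =>
    if l.length = 0 then some [] else
      l[(l.length - 1) / 2]?.map (· ++ [decide ((l.length - 1) % 2 = 1)])
  have hpred : Primrec fun l : List BinStr => l.length - 1 := Primrec.pred.comp Primrec.list_length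
  have hodd : Primrec fun l : List BinStr => decide ((l.length - 1) % 2 = 1) :=
    Primrec.eq.decide.comp (Primrec.nat_mod.comp hpred (Primrec.const 2)) (Primrec.const 1)
  have hnext : Primrec next :=
    Primrec.ite (Primrec.eq.comp Primrec.list_length (Primrec.const 0)) (Primrec.const (some []))
      (Primrec.option_map
        (Primrec.list_getElem?.comp Primrec.id (Primrec.nat_div.comp hpred (Primrec.const 2)))
        (Primrec.list_concat.comp Primrec.snd (hodd.comp Primrec.fst)))
  have h := Primrec.nat_strong_rec (fun (_ : Unit) n => strOfNat n) (g := fun _ l => next l)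
    (hnext.comp Primrec.snd) fun _ n => ?_
  · exact h.comp (Primrec.const ()) Primrec.id
  · rcases n with _ | n
    · simp [next]
    · have : n / 2 < n + 1 := by omega
      conv_rhs => rw [succ_eq_two_mul_half_add, strOfNat_two_mul_add]
      simp [next, this]

theorem two_pow_length_le_natOfStr_succ_lt (l : BinStr) :
    2 ^ l.length ≤ natOfStr l + 1 ∧ natOfStr l + 1 < 2 ^ (l.length + 1) := by
  induction l using List.reverseRecOn with
  | nil => simp [natOfStr]
  | append_singleton l b ih =>
    have hb : b.toNat ≤ 1 := Bool.toNat_le b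
    rw [natOfStr_append_singleton, List.length_append, List.length_singleton]
    rw [pow_succ] at ih ⊢
    rw [pow_succ, pow_succ]
    omega

theorem natOfStr_lt_two_pow_sub_one_iff {l : BinStr} {s : ℕ} :
    natOfStr l < 2 ^ s - 1 ↔ l.length < s := by
  obtain ⟨hle, hlt⟩ := two_pow_length_le_natOfStr_succ_lt l
  refine ⟨fun h => (Nat.pow_lt_pow_iff_right one_lt_two).1 (hle.trans_lt (by omega)), fun h => ?_⟩
  have := Nat.pow_le_pow_right two_pos (Nat.succ_le_of_lt h)
  omega

theorem length_strOfNat_lt_iff {n s : ℕ} : (strOfNat n).length < s ↔ n < 2 ^ s - 1 := by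
  rw [← natOfStr_lt_two_pow_sub_one_iff, natOfStr_strOfNat]

theorem length_strOfNat_two_pow_sub_one_add {j m : ℕ} (h : j < 2 ^ m) :
    (strOfNat (2 ^ m - 1 + j)).length = m := by
  refine le_antisymm (Nat.lt_succ_iff.1 (length_strOfNat_lt_iff.2 ?_))
    (not_lt.1 (mt length_strOfNat_lt_iff.1 ?_))
  · rw [pow_succ]
    omega
  · omega

section Enumerations

variable {β σ : Type*} [Primcodable β] [Primcodable σ]

theorem rePred_exists {R : β → ℕ → Prop} (hR : PrimrecRel R) : REPred fun a => ∃ t, R a t := by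
  classical
  let p : β → ℕ →. Bool := fun a t => Part.some (decide (R a t))
  refine (Partrec.dom_re (Partrec.rfind (p := p) hR.decide.to_comp)).of_eq fun a => ?_
  exact Nat.rfind_dom.trans (by simp [p])

theorem exists_primrec_enumeration {W : β → σ → Prop} (hW : REPred fun p : β × σ => W p.1 p.2) :
    ∃ g : β → ℕ → Option σ, Primrec₂ g ∧ ∀ a x, W a x ↔ ∃ p, g a p = some x := by
  obtain ⟨u, hu, -, hmem⟩ := exists_primrec_stages hW
  refine ⟨fun a p => (Encodable.decode (α := σ) p.unpair.2).bind fun x =>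
    (u p.unpair.1 (a, x)).map fun _ => x, ?_, fun a x => ?_⟩
  · have hunpair : Primrec fun y : (β × ℕ) × σ => y.1.2.unpair :=
      Primrec.unpair.comp (Primrec.snd.comp Primrec.fst)
    exact Primrec.option_bind (Primrec.decode.comp (Primrec.snd.comp (Primrec.unpair.comp
      Primrec.snd))) (Primrec.option_map (hu.comp (Primrec.fst.comp hunpair)
        ((Primrec.fst.comp Primrec.fst).pair Primrec.snd)) (Primrec.snd.comp Primrec.fst))
  · have hdom : W a x ↔ ∃ t, u t (a, x) = some () := by
      rw [← hmem]
      simp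
    rw [hdom]
    refine ⟨fun ⟨t, ht⟩ => ⟨Nat.pair t (Encodable.encode x), by simp [ht]⟩, fun ⟨p, hp⟩ => ?_⟩
    obtain ⟨y, -, hy⟩ := Option.bind_eq_some_iff.1 hp
    obtain ⟨_, ht, rfl⟩ := Option.map_eq_some_iff.1 hy
    exact ⟨_, ht⟩

/-- The number of distinct elements that the enumeration `g` has listed before stage `p`. -/
def numListed {σ : Type*} [DecidableEq σ] (g : ℕ → Option σ) (p : ℕ) : ℕ :=
  ((List.range p).filterMap g).toFinset.card

theorem primrec_numListed [DecidableEq σ] {g : β → ℕ → Option σ} (hg : Primrec₂ g) :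
    Primrec₂ fun a p => numListed (g a) p :=
  primrec_card_toFinset.comp (Primrec.listFilterMap (Primrec.list_range.comp Primrec.snd)
    (hg.comp (Primrec.fst.comp Primrec.fst) Primrec.snd))

theorem numListed_mono {σ : Type*} [DecidableEq σ] (g : ℕ → Option σ) : Monotone (numListed g) :=
  fun p q h => Finset.card_le_card fun x => by
    simp only [List.mem_toFinset, List.mem_filterMap, List.mem_range]
    exact fun ⟨i, hi, hx⟩ => ⟨i, hi.trans_le h, hx⟩

theorem exists_numListed_succ_eq {σ : Type*} [DecidableEq σ] {g : ℕ → Option σ} {x : σ}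
    (hx : ∃ p, g p = some x) :
    ∃ p, g p = some x ∧ numListed g (p + 1) = numListed g p + 1 := by
  refine ⟨Nat.find hx, Nat.find_spec hx, ?_⟩
  have hnew : x ∉ ((List.range (Nat.find hx)).filterMap g).toFinset := by
    simpa using fun i => Nat.find_min hx
  rw [numListed, List.range_succ, List.filterMap_append, List.toFinset_append, Finset.union_comm]
  simp [Nat.find_spec hx, Finset.card_insert_of_notMem hnew, numListed]

/-- `f (a, i)` is the `i`-th element of `W a` in an enumeration without repetitions. -/
theorem exists_partrec_of_card_le {W : β → σ → Prop} (hW : REPred fun p : β × σ => W p.1 p.2) :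
    ∃ f : β × ℕ →. σ, Partrec f ∧ ∀ a m, (∀ S : Finset σ, (∀ x ∈ S, W a x) → S.card ≤ m) →
      ∀ x, W a x → ∃ i < m, x ∈ f (a, i) := by
  classical
  obtain ⟨g, hg, hgW⟩ := exists_primrec_enumeration hW
  have hfound : PrimrecRel fun (y : β × ℕ) p => numListed (g y.1) (p + 1) = y.2 + 1 :=
    Primrec.eq.comp ((primrec_numListed hg).comp (Primrec.fst.comp Primrec.fst)
      (Primrec.succ.comp Primrec.snd)) (Primrec.succ.comp (Primrec.snd.comp Primrec.fst))
  refine ⟨fun y => (Nat.rfind fun p =>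
    Part.some (decide (numListed (g y.1) (p + 1) = y.2 + 1))).bind fun p => (g y.1 p : Part σ),
    Partrec.bind (Partrec.rfind hfound.decide.to_comp)
      (Computable.ofOption (hg.comp (Primrec.fst.comp Primrec.fst) Primrec.snd).to_comp), ?_⟩
  intro a m hm x hx
  obtain ⟨p, hpx, hp⟩ := exists_numListed_succ_eq ((hgW a x).1 hx)
  refine ⟨numListed (g a) p, ?_, Part.mem_bind (a := p)
    (Nat.mem_rfind.2 ⟨by simp [hp], fun {q} hq => ?_⟩) (by simp [hpx])⟩
  · rw [← Nat.succ_le_iff, Nat.succ_eq_add_one, ← hp]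
    refine hm _ fun y hy => ?_
    obtain ⟨q, -, hq⟩ := List.mem_filterMap.1 (List.mem_toFinset.1 hy)
    exact (hgW a y).2 ⟨q, hq⟩
  · have hle : numListed (g a) (q + 1) ≤ numListed (g a) p := numListed_mono (g a) hq
    simpa using (Nat.lt_succ_of_le hle).ne

end Enumerations

/-! ### Plain complexity -/

section Complexity

variable {U : BinStr → BinStr →. BinStr}

theorem C_le_length_program {x P : BinStr} (h : x ∈ U [] P) : C U x ≤ P.length :=
  Nat.sInf_le ⟨P, rfl, h⟩

/-- The number of leading ones of a string, the first component of the pair `(a, z)` that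
`1 ⋯ 1 0 z` with `a` ones encodes. -/
def unaryLen (P : BinStr) : ℕ := (P.takeWhile id).length

/-- What follows the block of leading ones and the zero that ends it, the second component of the
pair `(a, z)` that `1 ⋯ 1 0 z` with `a` ones encodes. -/
def unaryRest (P : BinStr) : BinStr := (P.dropWhile id).tail

theorem unaryLen_replicate (l : ℕ) (z : BinStr) :
    unaryLen (List.replicate l true ++ false :: z) = l := by
  induction l with
  | zero => simp [unaryLen]
  | succ l => simp [unaryLen, List.replicate_succ]

theorem unaryRest_replicate (l : ℕ) (z : BinStr) :
    unaryRest (List.replicate l true ++ false :: z) = z := by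
  induction l with
  | zero => simp [unaryRest]
  | succ l => simp [unaryRest, List.replicate_succ]

theorem IsUniversalOptimal.exists_C_le_add (hU : IsUniversalOptimal U)
    {V : ℕ → BinStr →. BinStr} (hV : Partrec₂ V) :
    ∃ d, ∀ a z x, x ∈ V a z → C U x ≤ a + z.length + d := by
  have hlen : Primrec unaryLen := Primrec.list_length.comp (Primrec.list_takeWhile Primrec.id)
  have hrest : Primrec unaryRest := Primrec.list_tail.comp (Primrec.list_dropWhile Primrec.id)
  obtain ⟨c, hc⟩ := hU.optimal (fun _ P => V (unaryLen P) (unaryRest P))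
    (hV.comp (hlen.to_comp.comp Computable.snd) (hrest.to_comp.comp Computable.snd))
  refine ⟨c + 1, fun a z x hx => ?_⟩
  obtain ⟨Q, hQ, hxQ⟩ := hc x [] (List.replicate a true ++ false :: z)
    (by rwa [unaryLen_replicate, unaryRest_replicate])
  have := (C_le_length_program hxQ).trans hQ
  simp only [List.length_append, List.length_replicate, List.length_cons] at this
  omega

theorem IsUniversalOptimal.exists_minimal_program (hU : IsUniversalOptimal U) (x : BinStr) :
    ∃ P : BinStr, P.length = C U x ∧ x ∈ U [] P := by
  obtain ⟨c, hc⟩ := hU.optimal (fun _ P => Part.some P) Computable.snd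
  obtain ⟨Q, -, hx⟩ := hc x [] x (Part.mem_some x)
  exact Nat.sInf_mem (s := {l : ℕ | ∃ P : BinStr, P.length = l ∧ x ∈ U [] P}) ⟨_, Q, rfl, hx⟩

theorem IsUniversalOptimal.C_lt_iff (hU : IsUniversalOptimal U) {x : BinStr} {s : ℕ} :
    C U x < s ↔ ∃ P : BinStr, P.length < s ∧ x ∈ U [] P := by
  refine ⟨fun h => ?_, fun ⟨P, hP, hx⟩ => (C_le_length_program hx).trans_lt hP⟩
  obtain ⟨P, hP, hx⟩ := hU.exists_minimal_program x
  exact ⟨P, hP ▸ h, hx⟩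

theorem IsUniversalOptimal.exists_C_le_length_add (hU : IsUniversalOptimal U) :
    ∃ d, ∀ x : BinStr, C U x ≤ x.length + d := by
  obtain ⟨d, hd⟩ := hU.exists_C_le_add (V := fun _ z => Part.some z) Computable.snd
  exact ⟨d, fun x => by simpa using hd 0 x x (Part.mem_some x)⟩

theorem IsUniversalOptimal.card_lt_two_pow (hU : IsUniversalOptimal U) {X : Finset BinStr} {s : ℕ}
    (hX : ∀ x ∈ X, C U x < s) : X.card < 2 ^ s := by
  choose! P hP hxP using fun x hx => hU.C_lt_iff.1 (hX x hx)
  have hmaps : ∀ x ∈ X, natOfStr (P x) ∈ Finset.range (2 ^ s - 1) := fun x hx =>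
    Finset.mem_range.2 (natOfStr_lt_two_pow_sub_one_iff.2 (hP x hx))
  have hinj : Set.InjOn (fun x => natOfStr (P x)) X := fun x hx y hy hxy => by
    have hPxy : P x = P y := by simpa using congrArg strOfNat hxy
    exact Part.mem_unique (hxP x hx) (hPxy ▸ hxP y hy)
  have hcard := Finset.card_le_card_of_injOn _ hmaps hinj
  have hpos : 0 < 2 ^ s := by positivity
  rw [Finset.card_range] at hcard
  omega

theorem IsUniversalOptimal.exists_le_CNat (hU : IsUniversalOptimal U) (m : ℕ) :
    ∃ j < 2 ^ m, m ≤ CNat U (2 ^ m - 1 + j) := by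
  by_contra! hcon
  have hcard := hU.card_lt_two_pow (s := m)
    (X := (Finset.range (2 ^ m)).image fun j => strOfNat (2 ^ m - 1 + j)) <| by
      simpa [CNat] using hcon
  have hinj : Function.Injective fun j => strOfNat (2 ^ m - 1 + j) :=
    strOfNat_injective.comp (add_right_injective _)
  rw [Finset.card_image_of_injective _ hinj, Finset.card_range] at hcard
  exact lt_irrefl _ hcard

theorem IsUniversalOptimal.exists_C_lt_stages (hU : IsUniversalOptimal U) :
    ∃ E : ℕ → ℕ → List BinStr, Primrec₂ E ∧ (∀ s t t', t ≤ t' → E s t ⊆ E s t') ∧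
      ∀ s x, C U x < s ↔ ∃ t, x ∈ E s t := by
  obtain ⟨u, hu, hmono, hmem⟩ := exists_primrec_stages
    (hU.partrec.comp (Computable.const []) Computable.id)
  refine ⟨fun s t => (List.range (2 ^ s - 1)).filterMap fun k => u t (strOfNat k), ?_, ?_, ?_⟩
  · exact Primrec.listFilterMap (Primrec.list_range.comp (Primrec.nat_sub.comp (primrec_pow.comp
      (Primrec.const 2) Primrec.fst) (Primrec.const 1))) (hu.comp (Primrec.snd.comp Primrec.fst)
        (primrec_strOfNat.comp Primrec.snd))
  · intro s t t' h x
    simp only [List.mem_filterMap]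
    exact fun ⟨k, hk, hx⟩ => ⟨k, hk, hmono t t' _ x h hx⟩
  · intro s x
    simp only [hU.C_lt_iff, List.mem_filterMap, List.mem_range]
    constructor
    · rintro ⟨P, hP, hx⟩
      obtain ⟨t, ht⟩ := (hmem P x).1 hx
      exact ⟨t, natOfStr P, natOfStr_lt_two_pow_sub_one_iff.2 hP, by rwa [strOfNat_natOfStr]⟩
    · rintro ⟨t, k, hk, hx⟩
      exact ⟨strOfNat k, length_strOfNat_lt_iff.2 hk, (hmem _ x).2 ⟨t, hx⟩⟩

/-- If `W (a, r)` has at most `2 ^ r` elements, then a string of length `r` suffices to give the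
index of any of them in an enumeration without repetitions. -/
theorem IsUniversalOptimal.exists_CNat_le_of_rePred (hU : IsUniversalOptimal U)
    {W : ℕ × ℕ → ℕ → Prop} (hW : REPred fun p : (ℕ × ℕ) × ℕ => W p.1 p.2) :
    ∃ d, ∀ a r, (∀ S : Finset ℕ, (∀ n ∈ S, W (a, r) n) → S.card ≤ 2 ^ r) →
      ∀ n, W (a, r) n → CNat U n ≤ a + r + d := by
  obtain ⟨f, hf, hfW⟩ := exists_partrec_of_card_le hW
  have hV : Partrec₂ fun (a : ℕ) (z : BinStr) =>
      (f ((a, z.length), natOfStr z - (2 ^ z.length - 1))).map strOfNat := by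
    have hlen : Primrec fun y : ℕ × BinStr => y.2.length := Primrec.list_length.comp Primrec.snd
    have hind : Primrec fun y : ℕ × BinStr => natOfStr y.2 - (2 ^ y.2.length - 1) :=
      Primrec.nat_sub.comp (primrec_natOfStr.comp Primrec.snd) (Primrec.pred.comp
        (primrec_pow.comp (Primrec.const 2) hlen))
    exact (hf.comp ((Primrec.fst.pair hlen).pair hind).to_comp).map
      (primrec_strOfNat.to_comp.comp Computable.snd)
  obtain ⟨d, hd⟩ := hU.exists_C_le_add hV
  refine ⟨d, fun a r hcard n hn => ?_⟩
  obtain ⟨i, hi, hfi⟩ := hfW (a, r) (2 ^ r) hcard n hn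
  have hlen := length_strOfNat_two_pow_sub_one_add hi
  have := hd a (strOfNat (2 ^ r - 1 + i)) (strOfNat n) <|
    (Part.mem_map_iff _).2 ⟨n, by simpa [hlen] using hfi, rfl⟩
  rwa [hlen] at this

end Complexity

section Counting

variable {U : BinStr → BinStr →. BinStr}

/-- At least `B` strings of length `n` have complexity less than `s`. -/
def HasManySimpleStrings (U : BinStr → BinStr →. BinStr) (B s n : ℕ) : Prop :=
  ∃ X : Finset BinStr, B ≤ X.card ∧ ∀ x ∈ X, x.length = n ∧ C U x < s

theorem IsUniversalOptimal.rePred_hasManySimpleStrings (hU : IsUniversalOptimal U) :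
    REPred fun p : (ℕ × ℕ) × ℕ => HasManySimpleStrings U p.1.1 p.1.2 p.2 := by
  obtain ⟨E, hE, hmono, hmem⟩ := hU.exists_C_lt_stages
  have hlist : Primrec fun y : ((ℕ × ℕ) × ℕ) × ℕ =>
      (E y.1.1.2 y.2).filter fun x => x.length = y.1.2 :=
    (PrimrecRel.listFilter (R := fun (x : BinStr) n => x.length = n) (Primrec.eq.comp
      (Primrec.list_length.comp Primrec.fst) Primrec.snd)).comp (hE.comp (Primrec.snd.comp
        (Primrec.fst.comp Primrec.fst)) Primrec.snd) (Primrec.snd.comp Primrec.fst)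
  have hR : PrimrecRel fun (y : (ℕ × ℕ) × ℕ) t =>
      y.1.1 ≤ ((E y.1.2 t).filter fun x => x.length = y.2).toFinset.card :=
    Primrec.nat_le.comp (Primrec.fst.comp (Primrec.fst.comp Primrec.fst))
      (primrec_card_toFinset.comp hlist)
  refine (rePred_exists hR).of_eq fun ⟨⟨B, s⟩, n⟩ => ⟨fun ⟨t, ht⟩ => ⟨_, ht, fun x hx => ?_⟩, ?_⟩
  · obtain ⟨hxt, hxn⟩ := by simpa using hx
    exact ⟨hxn, (hmem s x).2 ⟨t, hxt⟩⟩
  · rintro ⟨X, hBX, hX⟩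
    have hev : ∀ x ∈ X, ∀ᶠ t in Filter.atTop, x ∈ E s t := fun x hx => by
      obtain ⟨t, ht⟩ := (hmem s x).1 (hX x hx).2
      filter_upwards [Filter.eventually_ge_atTop t] with t' h' using hmono s t t' h' ht
    obtain ⟨t, ht⟩ := ((Filter.eventually_all_finset X).2 hev).exists
    exact ⟨t, hBX.trans (Finset.card_le_card fun x hx => by simp [ht x hx, (hX x hx).1])⟩

theorem IsUniversalOptimal.card_mul_lt_of_hasManySimpleStrings (hU : IsUniversalOptimal U)
    {B s : ℕ} {S : Finset ℕ} (hS : ∀ n ∈ S, HasManySimpleStrings U B s n) :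
    S.card * B < 2 ^ s := by
  choose! X hBX hX using hS
  have hdisj : (S : Set ℕ).PairwiseDisjoint X := fun n hn n' hn' hne =>
    Finset.disjoint_left.2 fun x hx hx' => hne ((hX n hn x hx).1.symm.trans (hX n' hn' x hx').1)
  calc S.card * B ≤ ∑ n ∈ S, (X n).card := Finset.card_nsmul_le_sum S _ B hBX
    _ = (S.biUnion X).card := (Finset.card_biUnion hdisj).symm
    _ < 2 ^ s := hU.card_lt_two_pow fun x hx => by
      obtain ⟨n, hn, hxn⟩ := Finset.mem_biUnion.1 hx
      exact (hX n hn x hxn).2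

/-- Fewer than `2 ^ r` lengths `n` have `2 ^ (2 * a + c)` strings of complexity less than
`m + c`, where `m = r + 2 * a`. Describing such an `n` by its index and by `a` costs
`r + a = m - a` bits up to a constant, which for large `a` is less than `m`. -/
theorem IsUniversalOptimal.exists_card_le_of_le_CNat (hU : IsUniversalOptimal U) (c : ℕ) :
    ∃ b m₀, ∀ m, m₀ ≤ m → ∀ n, m ≤ CNat U n → ∀ X : Finset BinStr,
      (∀ x ∈ X, x.length = n ∧ C U x < m + c) → X.card ≤ b := by
  let B : ℕ → ℕ := fun a => 2 ^ (2 * a + c)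
  let s : ℕ × ℕ → ℕ := fun y => y.2 + (2 * y.1 + c)
  have hexp : Primrec fun a : ℕ => 2 * a + c :=
    Primrec.nat_add.comp Primrec.nat_double (Primrec.const c)
  have hBs : Primrec fun y : (ℕ × ℕ) × ℕ => ((B y.1.1, s y.1), y.2) :=
    (((primrec_pow.comp (Primrec.const 2) hexp).comp (Primrec.fst.comp Primrec.fst)).pair
      (Primrec.nat_add.comp (Primrec.snd.comp Primrec.fst)
        (hexp.comp (Primrec.fst.comp Primrec.fst)))).pair Primrec.snd
  obtain ⟨d, hd⟩ := hU.exists_CNat_le_of_rePred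
    (W := fun y n => HasManySimpleStrings U (B y.1) (s y) n)
    (hU.rePred_hasManySimpleStrings.comp hBs.to_comp)
  obtain ⟨a, ha⟩ : ∃ a, a = d + 1 := ⟨_, rfl⟩
  refine ⟨B a, 2 * a, fun m hm n hn X hX => ?_⟩
  by_contra! hcard
  have hs : s (a, m - 2 * a) = m + c := by simp only [s]; omega
  have hle : CNat U n ≤ a + (m - 2 * a) + d := by
    refine hd a _ (fun S hS => ?_) n ⟨X, hcard.le, fun x hx => by rw [hs]; exact hX x hx⟩
    have hlt := hU.card_mul_lt_of_hasManySimpleStrings hS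
    rw [show s (a, m - 2 * a) = m - 2 * a + (2 * a + c) from rfl, pow_add] at hlt
    exact (Nat.lt_of_mul_lt_mul_right hlt).le
  omega

end Counting

/-! ### Sequences with bounded traces -/

section Traces

variable {β σ : Type*}

/-- The list of the first `n` terms of a sequence. -/
def firstValues (X : ℕ → σ) (n : ℕ) : List σ := (List.range n).map X

@[simp]
theorem length_firstValues (X : ℕ → σ) (n : ℕ) : (firstValues X n).length = n := by
  simp [firstValues]

theorem firstValues_succ (X : ℕ → σ) (n : ℕ) :
    firstValues X (n + 1) = firstValues X n ++ [X n] := by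
  simp [firstValues, List.range_succ]

theorem take_firstValues (X : ℕ → σ) {n m : ℕ} (h : n ≤ m) :
    (firstValues X m).take n = firstValues X n := by
  simp [firstValues, ← List.map_take, List.take_range, h]

theorem getElem?_firstValues (X : ℕ → σ) {i n : ℕ} (h : i < n) :
    (firstValues X n)[i]? = some (X i) := by
  simp [firstValues, h]

theorem toFinset_map_take [DecidableEq σ] (L : List (List σ)) (n : ℕ) :
    (L.map (List.take n)).toFinset = L.toFinset.image (List.take n) := by
  ext; simp

variable [Primcodable σ]

theorem primrec_map_take : Primrec₂ fun (n : ℕ) (L : List (List σ)) => L.map (List.take n) :=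
  Primrec.list_map Primrec.snd
    (Primrec.list_take.comp (Primrec.fst.comp Primrec.fst) Primrec.snd)

theorem computable_of_injOn_take {X : ℕ → σ} {F : ℕ → List (List σ)} (hF : Computable F)
    (hX : ∀ n, firstValues X n ∈ F n) {n₀ : ℕ}
    (hinj : ∀ n, n₀ ≤ n → Set.InjOn (List.take n₀) {l | l ∈ F n}) : Computable X := by
  classical
  let consistent : ℕ → List (List σ) := fun i =>
    (F (n₀ + i + 1)).filter fun l => l.take n₀ = firstValues X n₀
  have hconsistent : Computable consistent :=
    ((PrimrecRel.listFilter (R := fun (l l' : List σ) => l.take n₀ = l')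
      (Primrec.eq.comp (Primrec.list_take.comp (Primrec.const n₀) Primrec.fst)
        Primrec.snd)).comp Primrec.id (Primrec.const (firstValues X n₀))).to_comp.comp
      (hF.comp (Primrec.succ.comp (Primrec.nat_add.comp (Primrec.const n₀) Primrec.id)).to_comp)
  have hhead : ∀ i, (consistent i).head? = some (firstValues X (n₀ + i + 1)) := fun i => by
    have hmem : firstValues X (n₀ + i + 1) ∈ consistent i := by
      simpa [consistent, hX] using take_firstValues X (by omega)
    obtain ⟨l, L, hL⟩ := List.exists_cons_of_ne_nil (List.ne_nil_of_mem hmem)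
    obtain ⟨hl, htake⟩ : l ∈ F (n₀ + i + 1) ∧ l.take n₀ = firstValues X n₀ := by
      simpa [consistent] using (hL ▸ List.mem_cons_self : l ∈ consistent i)
    rw [hL, List.head?_cons, hinj _ (by omega) hl (hX _)
      (htake.trans (take_firstValues X (by omega)).symm)]
  have hget : Computable fun i => (consistent i).head?.bind fun l => l[i]? :=
    (Primrec.list_head?.to_comp.comp hconsistent).option_bind
      (Primrec.list_getElem?.to_comp.comp Computable.snd Computable.fst)
  refine Computable.option_some_iff.1 (hget.of_eq fun i => ?_)
  rw [hhead]
  exact getElem?_firstValues X (by omega)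

/-- If cutting `F j` to length `n` for some `j ≥ n` always leaves at most `w` candidates, then the
bound drops. Otherwise, beyond some `n₀`, the first `n₀` terms of `X` single it out. -/
theorem computable_of_trace [DecidableEq σ] {X : ℕ → σ} (w : ℕ) {F : ℕ → List (List σ)}
    (hF : Computable F) (hw : ∀ n, (F n).toFinset.card ≤ w) (hX : ∀ n, firstValues X n ∈ F n) :
    Computable X := by
  induction w generalizing F with
  | zero => exact absurd (hw 0) (Finset.card_pos.2 ⟨_, List.mem_toFinset.2 (hX 0)⟩).not_ge
  | succ w ih =>
    have hcard : ComputablePred fun p : ℕ × ℕ =>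
        p.1 ≤ p.2 ∧ ((F p.2).map (List.take p.1)).toFinset.card ≤ w :=
      computablePred_comp
        (p := fun y : (ℕ × ℕ) × List (List σ) =>
          y.1.1 ≤ y.1.2 ∧ (y.2.map (List.take y.1.1)).toFinset.card ≤ w)
        ((Primrec.nat_le.comp (Primrec.fst.comp Primrec.fst) (Primrec.snd.comp Primrec.fst)).and
          (Primrec.nat_le.comp (primrec_card_toFinset.comp (primrec_map_take.comp
            (Primrec.fst.comp Primrec.fst) Primrec.snd)) (Primrec.const w)))
        (Computable.id.pair (hF.comp Computable.snd))
    by_cases h : ∀ n, ∃ j, n ≤ j ∧ ((F j).map (List.take n)).toFinset.card ≤ w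
    · obtain ⟨j, hj, hjw⟩ := exists_computable_choice hcard h
      exact ih (primrec_map_take.to_comp.comp Computable.id (hF.comp hj)) (fun n => (hjw n).2)
        fun n => List.mem_map.2 ⟨_, hX (j n), take_firstValues X (hjw n).1⟩
    · push Not at h
      obtain ⟨n₀, hn₀⟩ := h
      refine computable_of_injOn_take hF hX (n₀ := n₀) fun n hn => ?_
      have hinj := Finset.card_image_iff.1 <| le_antisymm Finset.card_image_le <|
        (hw n).trans (toFinset_map_take (F n) n₀ ▸ hn₀ n hn)
      simpa using hinj

theorem mem_of_lt_card [DecidableEq β] {T : ℕ → List β} {w : ℕ}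
    (hmono : ∀ t t', t ≤ t' → T t ⊆ T t') (hw : ∀ t, (T t).toFinset.card ≤ w + 1) {x : β}
    (hx : ∃ t, x ∈ T t) {t : ℕ} (ht : w < (T t).toFinset.card) : x ∈ T t := by
  obtain ⟨t', ht'⟩ := hx
  have hsub : (T t).toFinset ⊆ (T (max t t')).toFinset := fun y => by
    simpa using fun hy => hmono t _ (le_max_left t t') hy
  have heq := Finset.eq_of_subset_of_card_le hsub ((hw _).trans ht)
  exact List.mem_toFinset.1 (heq ▸ List.mem_toFinset.2 (hmono t' _ (le_max_right t t') ht'))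

/-- A stage that lists `w + 1` candidates is complete. If such stages exist for arbitrarily large
`n`, then searching for them makes the trace computable; otherwise the bound drops. -/
theorem computable_of_ce_trace [DecidableEq σ] {X : ℕ → σ} (w : ℕ)
    {T : ℕ → ℕ → List (List σ)} (hT : Computable₂ T)
    (hmono : ∀ n t t', t ≤ t' → T n t ⊆ T n t') (hw : ∀ n t, (T n t).toFinset.card ≤ w)
    (hX : ∀ n, ∃ t, firstValues X n ∈ T n t) : Computable X := by
  induction w generalizing T with
  | zero =>
    obtain ⟨t, ht⟩ := hX 0
    exact absurd (hw 0 t) (Finset.card_pos.2 ⟨_, List.mem_toFinset.2 ht⟩).not_ge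
  | succ w ih =>
    by_cases h : ∀ n, ∃ p : ℕ, n ≤ p.unpair.1 ∧ w < (T p.unpair.1 p.unpair.2).toFinset.card
    · have hTp : Computable fun p : ℕ => T p.unpair.1 p.unpair.2 :=
        hT.comp (Computable.fst.comp Computable.unpair) (Computable.snd.comp Computable.unpair)
      have hcard : ComputablePred fun y : ℕ × ℕ =>
          y.1 ≤ y.2.unpair.1 ∧ w < (T y.2.unpair.1 y.2.unpair.2).toFinset.card :=
        computablePred_comp
          (p := fun y : (ℕ × ℕ) × List (List σ) => y.1.1 ≤ y.1.2.unpair.1 ∧ w < y.2.toFinset.card)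
          ((Primrec.nat_le.comp (Primrec.fst.comp Primrec.fst) (Primrec.fst.comp
            (Primrec.unpair.comp (Primrec.snd.comp Primrec.fst)))).and
              (Primrec.nat_lt.comp (Primrec.const w) (primrec_card_toFinset.comp Primrec.snd)))
          (Computable.id.pair (hTp.comp Computable.snd))
      obtain ⟨p, hp, hpw⟩ := exists_computable_choice hcard h
      refine computable_of_trace (w + 1) (F := fun n =>
        (T (p n).unpair.1 (p n).unpair.2).map (List.take n))
        (primrec_map_take.to_comp.comp Computable.id (hTp.comp hp))
        (fun n => ?_) fun n => ?_
      · rw [toFinset_map_take]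
        exact Finset.card_image_le.trans (hw _ _)
      · refine List.mem_map.2 ⟨_, ?_, take_firstValues X (hpw n).1⟩
        exact mem_of_lt_card (hmono _) (hw _) (hX _) (hpw n).2
    · push Not at h
      obtain ⟨n₀, hn₀⟩ := h
      refine ih (T := fun n t => (T (n₀ + n) t).map (List.take n)) ?_ (fun n t t' htt' => ?_)
        (fun n t => ?_) fun n => ?_
      · exact primrec_map_take.to_comp.comp Computable.fst (hT.comp
          (Primrec.nat_add.comp (Primrec.const n₀) Primrec.fst).to_comp Computable.snd)
      · exact List.map_subset _ (hmono _ t t' htt')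
      · rw [toFinset_map_take]
        exact Finset.card_image_le.trans (by simpa using hn₀ (Nat.pair (n₀ + n) t) (by simp))
      · obtain ⟨t, ht⟩ := hX (n₀ + n)
        exact ⟨t, List.mem_map.2 ⟨_, ht, take_firstValues X (by omega)⟩⟩

end Traces

/-! ### Chaitin's theorem -/

section Chaitin

variable {U : BinStr → BinStr →. BinStr}

/-- `x` has prefixes of all `2 ^ m` lengths whose strings `strOfNat` have length `m`, and these
prefixes lie in `S`. -/
def PrefixesIn (S : Set BinStr) (m : ℕ) (x : BinStr) : Prop :=
  ∀ j < 2 ^ m, 2 ^ m - 1 + j ≤ x.length ∧ x.take (2 ^ m - 1 + j) ∈ S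

theorem PrefixesIn.mono {S S' : Set BinStr} {m : ℕ} {x : BinStr} (hx : PrefixesIn S m x)
    (h : S ⊆ S') : PrefixesIn S' m x :=
  fun j hj => ⟨(hx j hj).1, h (hx j hj).2⟩

theorem primrecRel_prefixesIn :
    PrimrecRel fun (x : BinStr) (y : List BinStr × ℕ) => PrefixesIn {z | z ∈ y.1} y.2 x := by
  have hlen : Primrec fun y : ℕ × BinStr × List BinStr × ℕ => 2 ^ y.2.2.2 - 1 + y.1 :=
    Primrec.nat_add.comp (Primrec.pred.comp (primrec_pow.comp (Primrec.const 2)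
      (Primrec.snd.comp (Primrec.snd.comp Primrec.snd)))) Primrec.fst
  have hR : PrimrecRel fun (j : ℕ) (y : BinStr × List BinStr × ℕ) =>
      2 ^ y.2.2 - 1 + j ≤ y.1.length ∧ y.1.take (2 ^ y.2.2 - 1 + j) ∈ y.2.1 :=
    (Primrec.nat_le.comp hlen (Primrec.list_length.comp (Primrec.fst.comp Primrec.snd))).and
      (primrecRel_mem.comp (Primrec.list_take.comp hlen (Primrec.fst.comp Primrec.snd))
        (Primrec.fst.comp (Primrec.snd.comp Primrec.snd)))
  have hexp : Primrec fun y : BinStr × List BinStr × ℕ => 2 ^ y.2.2 :=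
    primrec_pow.comp (Primrec.const 2) (Primrec.snd.comp Primrec.snd)
  exact PrimrecPred.of_eq (hR.forall_mem_list.comp (Primrec.list_range.comp hexp) Primrec.id)
    fun y => by simp [PrefixesIn]

theorem exists_prefixesIn_stage {E : ℕ → List BinStr} (hE : ∀ t t', t ≤ t' → E t ⊆ E t')
    {m : ℕ} {x : BinStr} (hx : PrefixesIn {y | ∃ t, y ∈ E t} m x) :
    ∃ t, PrefixesIn {y | y ∈ E t} m x := by
  have hev : ∀ j ∈ Finset.range (2 ^ m), ∀ᶠ t in Filter.atTop, x.take (2 ^ m - 1 + j) ∈ E t :=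
    fun j hj => by
      obtain ⟨t, ht⟩ := (hx j (Finset.mem_range.1 hj)).2
      filter_upwards [Filter.eventually_ge_atTop t] with t' h using hE t t' h ht
  obtain ⟨t, ht⟩ := ((Filter.eventually_all_finset _).2 hev).exists
  exact ⟨t, fun j hj => ⟨(hx j hj).1, ht j (Finset.mem_range.2 hj)⟩⟩

theorem IsUniversalOptimal.exists_card_image_take_le (hU : IsUniversalOptimal U) (c : ℕ) :
    ∃ b m₀, ∀ m, m₀ ≤ m → ∀ X : Finset BinStr, (∀ x ∈ X, PrefixesIn {y | C U y < m + c} m x) →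
      ∀ n ≤ m, (X.image (List.take n)).card ≤ b := by
  obtain ⟨b, m₀, hb⟩ := hU.exists_card_le_of_le_CNat c
  refine ⟨b, m₀, fun m hm X hX n hn => ?_⟩
  obtain ⟨j, hj, hjm⟩ := hU.exists_le_CNat m
  have hnj : n ≤ 2 ^ m - 1 + j := by
    have : m < 2 ^ m := Nat.lt_two_pow_self
    omega
  calc (X.image (List.take n)).card
      = ((X.image (List.take (2 ^ m - 1 + j))).image (List.take n)).card := by
        simp [Finset.image_image, Function.comp_def, List.take_take, hnj]
    _ ≤ (X.image (List.take (2 ^ m - 1 + j))).card := Finset.card_image_le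
    _ ≤ b := hb m hm _ hjm _ fun y hy => by
        obtain ⟨x, hx, rfl⟩ := Finset.mem_image.1 hy
        exact ⟨List.length_take_of_le (hX x hx j hj).1, (hX x hx j hj).2⟩

theorem IsUniversalOptimal.exists_prefixesIn_firstValues (hU : IsUniversalOptimal U) (k : ℕ) :
    ∃ c, ∀ X : ℕ → Bool, (∀ n, C U (firstValues X n) ≤ CNat U n + k) →
      ∀ m, PrefixesIn {y | C U y < m + c} m (firstValues X (2 ^ m - 1 + (2 ^ m - 1))) := by
  obtain ⟨d, hd⟩ := hU.exists_C_le_length_add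
  refine ⟨d + k + 1, fun X hX m j hj => ?_⟩
  have hjm : 2 ^ m - 1 + j ≤ 2 ^ m - 1 + (2 ^ m - 1) := by omega
  have hlen := hd (strOfNat (2 ^ m - 1 + j))
  rw [length_strOfNat_two_pow_sub_one_add hj] at hlen
  have hC := hX (2 ^ m - 1 + j)
  rw [CNat] at hC
  exact ⟨by simpa using hjm, by rw [take_firstValues X hjm, Set.mem_ofPred_eq]; omega⟩

theorem IsUniversalOptimal.computable_of_C_firstValues_le (hU : IsUniversalOptimal U)
    {X : ℕ → Bool} {k : ℕ} (hX : ∀ n, C U (firstValues X n) ≤ CNat U n + k) : Computable X := by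
  classical
  obtain ⟨E, hE, hmono, hmem⟩ := hU.exists_C_lt_stages
  obtain ⟨c, hc⟩ := hU.exists_prefixesIn_firstValues k
  obtain ⟨b, m₀, hb⟩ := hU.exists_card_image_take_le c
  let candidates : ℕ → ℕ → List BinStr := fun m t =>
    (E (m + c) t).filter fun x => PrefixesIn {y | y ∈ E (m + c) t} m x
  have hcandidates : Primrec₂ candidates := by
    have hEc : Primrec fun y : ℕ × ℕ => E (y.1 + c) y.2 :=
      hE.comp (Primrec.nat_add.comp Primrec.fst (Primrec.const c)) Primrec.snd
    exact primrecRel_prefixesIn.listFilter.comp hEc (hEc.pair Primrec.fst)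
  refine computable_of_ce_trace b (T := fun n t => (candidates (m₀ + n) t).map (List.take n))
    ?_ (fun n t t' h => List.map_subset _ fun x => ?_) (fun n t => ?_) fun n => ?_
  · exact (primrec_map_take.comp Primrec.fst (hcandidates.comp
      (Primrec.nat_add.comp (Primrec.const m₀) Primrec.fst) Primrec.snd)).to_comp
  · simp only [candidates, List.mem_filter, decide_eq_true_eq]
    exact fun ⟨hx, hpre⟩ => ⟨hmono _ t t' h hx, hpre.mono (hmono _ t t' h)⟩
  · rw [toFinset_map_take]
    refine hb (m₀ + n) le_self_add _ (fun x hx => ?_) n le_add_self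
    simp only [candidates, List.mem_toFinset, List.mem_filter, decide_eq_true_eq] at hx
    exact hx.2.mono fun y hy => (hmem _ y).2 ⟨t, hy⟩
  · obtain ⟨t, ht⟩ := exists_prefixesIn_stage (hmono (m₀ + n + c))
      ((hc X hX (m₀ + n)).mono fun y hy => (hmem _ y).1 hy)
    have hpos : m₀ + n < 2 ^ (m₀ + n) := Nat.lt_two_pow_self
    have hx := (ht (2 ^ (m₀ + n) - 1) (by omega)).2
    rw [List.take_of_length_le (by simp)] at hx
    exact ⟨t, List.mem_map.2 ⟨_, List.mem_filter.2 ⟨hx, decide_eq_true ht⟩,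
      take_firstValues X (by omega)⟩⟩

end Chaitin

/-! ### Binary digits of reals -/

theorem bit_eq (x : ℝ) (i : ℕ) : bit x i = decide (⌊x * 2 ^ (i + 1)⌋ % 2 = 1) := by
  have hfract : ⌊x * 2 ^ (i + 1)⌋ = ⌊Int.fract x * 2 ^ (i + 1)⌋ + ⌊x⌋ * 2 ^ i * 2 := by
    rw [← Int.floor_add_intCast]
    congr 1
    push_cast
    linear_combination (-2 ^ (i + 1)) * Int.fract_add_floor x
  have hnonneg : 0 ≤ Int.fract x * 2 ^ (i + 1) := mul_nonneg (Int.fract_nonneg x) (by positivity)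
  rw [bit, Real.digits, decide_eq_decide, hfract, ← Int.natCast_floor_eq_floor hnonneg,
    Int.add_mul_emod_self_right, Fin.ext_iff]
  simp only [Fin.val_ofNat, Nat.cast_ofNat, Fin.val_one]
  omega

theorem floor_mul_two_pow_succ (x : ℝ) (n : ℕ) :
    ⌊x * 2 ^ (n + 1)⌋ = 2 * ⌊x * 2 ^ n⌋ + (bit x n).toNat := by
  have hdiv : ⌊x * 2 ^ n⌋ = ⌊x * 2 ^ (n + 1)⌋ / 2 := by
    rw [show x * 2 ^ n = x * 2 ^ (n + 1) / (2 : ℕ) by push_cast; ring, Int.floor_div_natCast]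
    rfl
  rw [hdiv, bit_eq]
  by_cases h : ⌊x * 2 ^ (n + 1)⌋ % 2 = 1 <;> simp [h] <;> omega

theorem initSeg_eq_firstValues (x : ℝ) (n : ℕ) : initSeg x n = firstValues (bit x) n := rfl

theorem initSeg_eq_iff_floor_eq {x y : ℝ} (hxy : ⌊x⌋ = ⌊y⌋) (n : ℕ) :
    initSeg x n = initSeg y n ↔ ⌊x * 2 ^ n⌋ = ⌊y * 2 ^ n⌋ := by
  induction n with
  | zero => simp [initSeg, hxy]
  | succ n ih =>
    rw [initSeg_eq_firstValues, initSeg_eq_firstValues, firstValues_succ, firstValues_succ,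
      List.append_singleton_inj, ← initSeg_eq_firstValues, ← initSeg_eq_firstValues, ih,
      floor_mul_two_pow_succ, floor_mul_two_pow_succ]
    cases bit x n <;> cases bit y n <;> simp <;> omega

/-- A dyadic rational, the quotient of an integer by a power of two. -/
def IsDyadic (x : ℝ) : Prop := ∃ (n : ℕ) (z : ℤ), x * 2 ^ n = z

theorem IsDyadic.isComputableReal {x : ℝ} (hx : IsDyadic x) : IsComputableReal x := by
  obtain ⟨n, z, hz⟩ := hx
  have hbit : ∀ i, n ≤ i → bit x i = false := fun i hi => by
    have hmul : x * 2 ^ (i + 1) = ((z * 2 ^ (i - n) * 2 : ℤ) : ℝ) := by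
      push_cast
      rw [← hz, show i + 1 = n + (i - n) + 1 by omega]
      ring
    rw [bit_eq, hmul, Int.floor_intCast]
    simp
  refine ((Primrec.list_getD false).comp (Primrec.const (firstValues (bit x) n))
    Primrec.id).to_comp.of_eq fun i => ?_
  rcases lt_or_ge i n with hi | hi
  · simp [List.getD_eq_getElem?_getD, getElem?_firstValues (bit x) hi]
  · rw [hbit i hi, List.getD_eq_default]
    simpa using hi

theorem exists_initSeg_eq_iff_le {α : ℝ} (hα : ¬ IsDyadic α) {x : ℕ → ℝ} (hmono : Monotone x)
    (hlim : Filter.Tendsto x Filter.atTop (nhds α)) :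
    ∃ (s₀ : ℕ) (μ : ℕ → ℕ), ∀ n s, s₀ ≤ s → (initSeg (x s) n = initSeg α n ↔ μ n ≤ s) := by
  have hle : ∀ s, x s ≤ α := fun s => hmono.ge_of_tendsto hlim s
  have hfloor : ∀ n, ∃ s, ⌊x s * 2 ^ n⌋ = ⌊α * 2 ^ n⌋ := fun n => by
    have hlt : (⌊α * 2 ^ n⌋ : ℝ) < α * 2 ^ n :=
      (Int.floor_le _).lt_of_ne fun h => hα ⟨n, _, h.symm⟩
    obtain ⟨s, hs⟩ := ((hlim.mul_const (2 ^ n)).eventually (lt_mem_nhds hlt)).exists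
    exact ⟨s, (Int.floor_mono (mul_le_mul_of_nonneg_right (hle s) (by positivity))).antisymm
      (Int.le_floor.2 hs.le)⟩
  have hsettled : ∀ n s t, s ≤ t → ⌊x s * 2 ^ n⌋ = ⌊α * 2 ^ n⌋ → ⌊x t * 2 ^ n⌋ = ⌊α * 2 ^ n⌋ := by
    refine fun n s t hst hs =>
      (Int.floor_mono (mul_le_mul_of_nonneg_right (hle t) (by positivity))).antisymm ?_
    rw [← hs]
    exact Int.floor_mono (mul_le_mul_of_nonneg_right (hmono hst) (by positivity))
  have hiff : ∀ n s, Nat.find (hfloor n) ≤ s ↔ ⌊x s * 2 ^ n⌋ = ⌊α * 2 ^ n⌋ := fun n s =>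
    ⟨fun h => hsettled n _ s h (Nat.find_spec (hfloor n)), Nat.find_min' (hfloor n)⟩
  refine ⟨Nat.find (hfloor 0), fun n => Nat.find (hfloor n), fun n s hs => ?_⟩
  rw [hiff, initSeg_eq_iff_floor_eq]
  simpa using (hiff 0 s).1 hs

theorem ApproximatesFromBelow.exists_initSeg_eq_iff_le {α : ℝ} (hα : ¬ IsDyadic α) {q : ℕ → ℕ}
    (hq : ApproximatesFromBelow q α) :
    ∃ (s₀ : ℕ) (μ : ℕ → ℕ), ∀ n s, s₀ ≤ s →
      (initSeg ((ratOfNat (q s) : ℚ) : ℝ) n = initSeg α n ↔ μ n ≤ s) :=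
  LeftCE.exists_initSeg_eq_iff_le hα (fun _ _ h => Rat.cast_le.2 (hq.1 h)) hq.2

/-- Adding the integer `b` to the rational `(a - b) / (c + 1)` makes it nonnegative without
changing its digits, which can then be found by division of natural numbers. -/
theorem bit_ratOfNat (m i : ℕ) :
    bit ((ratOfNat m : ℚ) : ℝ) i = decide
      ((m.unpair.1.unpair.1 + m.unpair.1.unpair.2 * m.unpair.2) * 2 ^ (i + 1) /
        (m.unpair.2 + 1) % 2 = 1) := by
  rw [bit_eq, ratOfNat, decide_eq_decide]
  generalize m.unpair.1.unpair.1 = a, m.unpair.1.unpair.2 = b, m.unpair.2 = c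
  have hshift : ((((a : ℚ) - b) / (c + 1) : ℚ) : ℝ) * 2 ^ (i + 1) =
      (((a + b * c) * 2 ^ (i + 1) : ℕ) : ℝ) / ((c + 1 : ℕ) : ℝ) - ((b * 2 ^ i * 2 : ℤ) : ℝ) := by
    have : (c : ℝ) + 1 ≠ 0 := by positivity
    push_cast
    field_simp
    ring
  rw [hshift, Int.floor_sub_intCast, Int.floor_div_natCast, Int.floor_natCast]
  omega

theorem primrec_initSeg_ratOfNat : Primrec₂ fun m n : ℕ => initSeg ((ratOfNat m : ℚ) : ℝ) n := by
  have hc : Primrec fun y : ℕ × ℕ => y.1.unpair := Primrec.unpair.comp Primrec.fst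
  have hab : Primrec fun y : ℕ × ℕ => y.1.unpair.1.unpair :=
    Primrec.unpair.comp (Primrec.fst.comp hc)
  have hnum : Primrec fun y : ℕ × ℕ => (y.1.unpair.1.unpair.1 + y.1.unpair.1.unpair.2 *
      y.1.unpair.2) * 2 ^ (y.2 + 1) :=
    Primrec.nat_mul.comp (Primrec.nat_add.comp (Primrec.fst.comp hab) (Primrec.nat_mul.comp
      (Primrec.snd.comp hab) (Primrec.snd.comp hc)))
        (primrec_pow.comp (Primrec.const 2) (Primrec.succ.comp Primrec.snd))
  have hbit : Primrec₂ fun m i : ℕ => bit ((ratOfNat m : ℚ) : ℝ) i :=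
    (Primrec.eq.decide.comp (Primrec.nat_mod.comp (Primrec.nat_div.comp hnum
      (Primrec.succ.comp (Primrec.snd.comp hc))) (Primrec.const 2)) (Primrec.const 1)).of_eq
        fun y => (bit_ratOfNat y.1 y.2).symm
  exact Primrec.list_map (Primrec.list_range.comp Primrec.snd)
    (hbit.comp (Primrec.fst.comp Primrec.fst) Primrec.snd)

/-! ### Relative computability -/

section Oracles

open Encodable

variable {O : Set (ℕ →. ℕ)}

theorem recursiveIn_comp_total {f : ℕ →. ℕ} {g : ℕ → ℕ} (hf : Nat.RecursiveIn O f)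
    (hg : Nat.RecursiveIn O fun n => Part.some (g n)) : Nat.RecursiveIn O fun n => f (g n) :=
  (Nat.RecursiveIn.comp hf hg).of_eq fun _ => Part.bind_some _ _

theorem recursiveIn_pair_total {f g : ℕ → ℕ} (hf : Nat.RecursiveIn O fun n => Part.some (f n))
    (hg : Nat.RecursiveIn O fun n => Part.some (g n)) :
    Nat.RecursiveIn O fun n => Part.some (Nat.pair (f n) (g n)) :=
  (Nat.RecursiveIn.pair hf hg).of_eq fun n => by simp [Seq.seq]

theorem recursiveIn_rec_total {h : ℕ → ℕ} (a : ℕ)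
    (hh : Nat.RecursiveIn O fun n => Part.some (h n)) :
    Nat.RecursiveIn O fun n => Part.some (Nat.rec a (fun i y => h (Nat.pair i y)) n) := by
  have hrec := Nat.RecursiveIn.prec (Nat.Primrec.const a).recursiveIn
    (recursiveIn_comp_total hh .right)
  have hpair : Nat.RecursiveIn O fun n => Part.some (Nat.pair 0 n) :=
    (Primrec.nat_iff.1 (Primrec₂.natPair.comp (Primrec.const 0) Primrec.id)).recursiveIn
  refine (recursiveIn_comp_total hrec hpair).of_eq fun n => ?_
  simp only [Nat.unpair_pair]
  induction n with
  | zero => rfl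
  | succ n ih =>
    simp only [ih]
    exact Part.bind_some _ _

variable {σ : Type*} [Primcodable σ]

theorem recursiveIn_encode_firstValues {X : ℕ → σ}
    (hX : Nat.RecursiveIn O fun n => Part.some (encode (X n))) :
    Nat.RecursiveIn O fun n => Part.some (encode (firstValues X n)) := by
  let append : ℕ → ℕ := fun p => encode (((decode p.unpair.1 : Option (List σ)).bind fun l =>
    (decode p.unpair.2 : Option σ).map fun a => l ++ [a]).getD [])
  have happend : Primrec append := by
    refine Primrec.encode.comp (Primrec.option_getD.comp (Primrec.option_bind
      (Primrec.decode.comp (Primrec.fst.comp Primrec.unpair)) ?_) (Primrec.const []))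
    exact Primrec.option_map
      (Primrec.decode.comp (Primrec.snd.comp (Primrec.unpair.comp Primrec.fst)))
      (Primrec.list_concat.comp (Primrec.snd.comp Primrec.fst) Primrec.snd)
  have happend_encode : ∀ (l : List σ) (a : σ),
      append (Nat.pair (encode l) (encode a)) = encode (l ++ [a]) := by
    simp [append]
  have hterm : Nat.RecursiveIn O fun p => Part.some (encode (X p.unpair.1)) :=
    recursiveIn_comp_total (f := fun n => Part.some (encode (X n))) hX .left
  have hstep : Nat.RecursiveIn O fun p =>
      Part.some (append (Nat.pair p.unpair.2 (encode (X p.unpair.1)))) :=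
    recursiveIn_comp_total (f := fun p => Part.some (append p))
      (Primrec.nat_iff.1 happend).recursiveIn
      (recursiveIn_pair_total .right hterm)
  refine (recursiveIn_rec_total (encode ([] : List σ)) hstep).of_eq fun n =>
    congrArg Part.some ?_
  induction n with
  | zero => rfl
  | succ n ih =>
    rw [firstValues_succ, ← happend_encode, ← ih]
    simp only [Nat.unpair_pair]

theorem recursiveIn_of_firstValues {X : ℕ → σ}
    (hX : Nat.RecursiveIn O fun n => Part.some (encode (X n))) {G : ℕ → List σ →. ℕ}
    (hG : Partrec₂ G) : Nat.RecursiveIn O fun n => G n (firstValues X n) := by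
  let G' : ℕ →. ℕ := fun p => (decode (α := List σ) p.unpair.2 : Part (List σ)).bind
    fun l => G p.unpair.1 l
  have hG' : Partrec G' :=
    (Computable.ofOption (Computable.decode.comp (Computable.snd.comp Computable.unpair))).bind
      (hG.comp (Computable.fst.comp (Computable.unpair.comp Computable.fst)) Computable.snd)
  refine (recursiveIn_comp_total (Partrec.nat_iff.1 hG').recursiveIn (recursiveIn_pair_total
    (Primrec.nat_iff.1 Primrec.id).recursiveIn (recursiveIn_encode_firstValues hX))).of_eq
      fun n => ?_
  simp [G']

end Oracles

/-! ### The halting time as a clock -/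

section HaltingTime

/-- Whether the `e`-th program halts on input `e` within `s` steps. -/
def haltsWithin (e s : ℕ) : Bool :=
  (Nat.Partrec.Code.evaln s (Denumerable.ofNat Nat.Partrec.Code e) e).isSome

theorem primrec_haltsWithin : Primrec₂ haltsWithin :=
  Primrec.option_isSome.comp (Nat.Partrec.Code.primrec_evaln.comp
    ((Primrec.snd.pair ((Primrec.ofNat _).comp Primrec.fst)).pair Primrec.fst))

theorem haltsWithin_mono {e s t : ℕ} (hst : s ≤ t) (h : haltsWithin e s) : haltsWithin e t := by
  obtain ⟨x, hx⟩ := Option.isSome_iff_exists.1 h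
  exact Option.isSome_iff_exists.2 ⟨x, Nat.Partrec.Code.evaln_mono hst hx⟩

theorem eval_dom_iff_exists_haltsWithin (e : ℕ) :
    ((Denumerable.ofNat Nat.Partrec.Code e).eval e).Dom ↔ ∃ s, haltsWithin e s := by
  simp only [Part.dom_iff_mem, Nat.Partrec.Code.evaln_complete, haltsWithin,
    Option.isSome_iff_exists, Option.mem_def]
  exact exists_comm

/-- The number of steps that the `e`-th program makes on input `e`, undefined if it does not
halt. -/
def haltingTime (e : ℕ) : Part ℕ := Nat.rfind fun s => Part.some (haltsWithin e s)

theorem partrec_haltingTime : Partrec haltingTime := Partrec.rfind primrec_haltsWithin.to_comp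

theorem haltsWithin_iff_exists_haltingTime_le {e t : ℕ} :
    haltsWithin e t ↔ ∃ s ∈ haltingTime e, s ≤ t := by
  refine ⟨fun h => ?_, fun ⟨s, hs, hst⟩ => haltsWithin_mono hst ?_⟩
  · obtain ⟨s, hs, hst⟩ := Nat.rfind_min' (p := haltsWithin e) h
    exact ⟨s, hs, hst⟩
  · simpa using (Nat.mem_rfind.1 hs).1

theorem haltingChar_eq_haltsWithin {e t : ℕ} (ht : ∀ s ∈ haltingTime e, s ≤ t) :
    haltingChar e = Part.some (haltsWithin e t).toNat := by
  have hiff : ((Denumerable.ofNat Nat.Partrec.Code e).eval e).Dom ↔ haltsWithin e t := by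
    rw [eval_dom_iff_exists_haltsWithin]
    refine ⟨fun ⟨s, hs⟩ => ?_, fun h => ⟨t, h⟩⟩
    obtain ⟨r, hr, -⟩ := haltsWithin_iff_exists_haltingTime_le.1 hs
    exact haltsWithin_iff_exists_haltingTime_le.2 ⟨r, hr, ht r hr⟩
  simp only [haltingChar, hiff]
  cases haltsWithin e t <;> rfl

theorem exists_haltingTime_le_of_finite {S : Set ℕ} (hS : S.Finite) :
    ∃ M, ∀ e ∈ S, ∀ s ∈ haltingTime e, s ≤ M := by
  have hfin : (⋃ e ∈ S, {s | s ∈ haltingTime e}).Finite := hS.biUnion fun e _ =>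
    Set.Subsingleton.finite fun _ hs _ ht => Part.mem_unique hs ht
  obtain ⟨M, hM⟩ := hfin.bddAbove
  exact ⟨M, fun e he s hs => hM (Set.mem_biUnion he hs)⟩

variable {σ : Type*} [Primcodable σ]

/-- Otherwise, for all but finitely many `e`, the stage at which the first `e` terms settle, which
the oracle can find, bounds the halting time of the `e`-th program. -/
theorem infinite_settled_at_haltingTime {O : Set (ℕ →. ℕ)} (hO : ¬ Nat.RecursiveIn O haltingChar)
    {X : ℕ → σ} (hX : Nat.RecursiveIn O fun n => Part.some (Encodable.encode (X n)))
    {A : ℕ → ℕ → List σ} (hA : Computable₂ A) {s₀ : ℕ} {μ : ℕ → ℕ}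
    (hμ : ∀ n s, s₀ ≤ s → (A s n = firstValues X n ↔ μ n ≤ s)) :
    {e | ∃ s ∈ haltingTime e, A s e = firstValues X e}.Infinite := by
  classical
  intro hfin
  obtain ⟨M, hM⟩ := exists_haltingTime_le_of_finite hfin
  let decideAt : ℕ → List σ →. ℕ := fun e l =>
    (Nat.rfind fun s => Part.some (decide (max s₀ M ≤ s ∧ A s e = l))).map
      fun s => (haltsWithin e s).toNat
  have hdecideAt : Partrec₂ decideAt := by
    have htest : Computable₂ fun (p : ℕ × List σ) (s : ℕ) =>
        decide (max s₀ M ≤ s ∧ A s p.1 = p.2) := by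
      have hle : PrimrecPred fun q : ℕ × List σ × List σ => max s₀ M ≤ q.1 ∧ q.2.1 = q.2.2 :=
        (Primrec.nat_le.comp (Primrec.const _) Primrec.fst).and
          (Primrec.eq.comp (Primrec.fst.comp Primrec.snd) (Primrec.snd.comp Primrec.snd))
      exact hle.decide.to_comp.comp (Computable.snd.pair ((hA.comp Computable.snd
        (Computable.fst.comp Computable.fst)).pair (Computable.snd.comp Computable.fst)))
    exact (Partrec.rfind htest.partrec₂).map ((Primrec.dom_bool Bool.toNat).to_comp.comp
      (primrec_haltsWithin.to_comp.comp (Computable.fst.comp Computable.fst) Computable.snd))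
  refine hO ((recursiveIn_of_firstValues hX hdecideAt).of_eq fun e => ?_)
  obtain ⟨s, hs, -⟩ := Nat.rfind_min'
    (p := fun s => decide (max s₀ M ≤ s ∧ A s e = firstValues X e))
    (m := max (max s₀ M) (μ e)) <| decide_eq_true
      ⟨le_max_left _ _, (hμ e _ (le_max_of_le_left (le_max_left _ _))).2 (le_max_right _ _)⟩
  obtain ⟨⟨hs₀, hsM⟩, hsμ⟩ : (s₀ ≤ s ∧ M ≤ s) ∧ A s e = firstValues X e := by
    simpa using Nat.rfind_spec hs
  rw [hμ e s hs₀] at hsμ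
  have hbound : ∀ r ∈ haltingTime e, r ≤ s := fun r hr => by
    by_contra! hsr
    have hsettled : A r e = firstValues X e := (hμ e r (hs₀.trans hsr.le)).2 (hsμ.trans hsr.le)
    exact (hsM.trans_lt hsr).not_ge (hM e ⟨r, hr, hsettled⟩ r hr)
  rw [haltingChar_eq_haltsWithin hbound]
  exact Part.eq_some_iff.2 (Part.mem_map _ hs)

end HaltingTime

/-! ### Programs for left c.e. reals -/

section Programs

variable {U : BinStr → BinStr →. BinStr}

theorem IsUniversalOptimal.computable_of_program (hU : IsUniversalOptimal U) {P : BinStr}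
    {q : ℕ → ℕ} (hq : ∀ s, strOfNat (q s) ∈ U (strOfNat s) P) : Computable q := by
  have h : Partrec fun s : ℕ => (U (strOfNat s) P).map natOfStr :=
    (hU.partrec.comp primrec_strOfNat.to_comp (Computable.const P)).map
      (primrec_natOfStr.to_comp.comp Computable.snd)
  exact h.of_eq_tot fun s => (Part.mem_map_iff _).2 ⟨_, hq s, natOfStr_strOfNat _⟩

theorem IsUniversalOptimal.exists_enumerates (hU : IsUniversalOptimal U) {α : ℝ}
    (hα : IsLeftCE α) : ∃ P, Enumerates U P α := by
  obtain ⟨q, hq, hqα⟩ := hα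
  obtain ⟨P, hP⟩ := hU.universal (fun y => Part.some (strOfNat (q (natOfStr y))))
    (primrec_strOfNat.to_comp.comp (hq.comp primrec_natOfStr.to_comp))
  exact ⟨P, q, fun s => by simp [hP], hqα⟩

/-- The machine that, given a concatenation of two programs `P` of length `l` and `Q`, computes the
number `n` with program `Q`, waits until the `n`-th program halts on input `n`, and outputs the
first `n` digits of the rational that `P` computes from the number of steps. -/
noncomputable def haltingClockMachine (U : BinStr → BinStr →. BinStr) (l : ℕ) : BinStr →. BinStr :=
  fun R => (U [] (R.drop l)).bind fun x => (haltingTime (natOfStr x)).bind fun s =>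
    (U (strOfNat s) (R.take l)).map fun y =>
      initSeg ((ratOfNat (natOfStr y) : ℚ) : ℝ) (natOfStr x)

theorem IsUniversalOptimal.partrec_haltingClockMachine (hU : IsUniversalOptimal U) :
    Partrec₂ (haltingClockMachine U) := by
  have hx : Partrec fun p : ℕ × BinStr => U [] (p.2.drop p.1) :=
    hU.partrec.comp (Computable.const _) Primrec.list_drop.to_comp
  refine hx.bind (Partrec.bind (partrec_haltingTime.comp
    (primrec_natOfStr.to_comp.comp Computable.snd)) ?_)
  have htake : Primrec fun p : ((ℕ × BinStr) × BinStr) × ℕ => p.1.1.2.take p.1.1.1 :=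
    have hlR : Primrec fun p : ((ℕ × BinStr) × BinStr) × ℕ => p.1.1 := Primrec.fst.comp Primrec.fst
    Primrec.list_take.comp (Primrec.fst.comp hlR) (Primrec.snd.comp hlR)
  have hy : Partrec fun p : ((ℕ × BinStr) × BinStr) × ℕ =>
      U (strOfNat p.2) (p.1.1.2.take p.1.1.1) :=
    hU.partrec.comp (primrec_strOfNat.to_comp.comp Computable.snd) htake.to_comp
  exact hy.map (primrec_initSeg_ratOfNat.comp (primrec_natOfStr.comp Primrec.snd)
    (primrec_natOfStr.comp (Primrec.snd.comp (Primrec.fst.comp Primrec.fst)))).to_comp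

theorem mem_haltingClockMachine {P Q : BinStr} {n s m : ℕ} (hQ : strOfNat n ∈ U [] Q)
    (hs : s ∈ haltingTime n) (hP : strOfNat m ∈ U (strOfNat s) P) :
    initSeg ((ratOfNat m : ℚ) : ℝ) n ∈ haltingClockMachine U P.length (P ++ Q) := by
  rw [haltingClockMachine, List.drop_left, List.take_left]
  refine Part.mem_bind hQ (Part.mem_bind (a := s) ?_ ((Part.mem_map_iff _).2 ⟨_, hP, ?_⟩)) <;>
    simp only [natOfStr_strOfNat, hs]

theorem recursiveIn_oracle (α : ℝ) :
    Nat.RecursiveIn {oracle α} fun n => Part.some (Encodable.encode (bit α n)) := by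
  have horacle : (fun n => Part.some (Encodable.encode (bit α n))) = oracle α := funext fun n => by
    cases h : bit α n <;> simp [oracle, h]
  rw [horacle]
  exact .oracle _ rfl

theorem IsUniversalOptimal.exists_infinite_C_initSeg_lt (hU : IsUniversalOptimal U) :
    ∃ c, ∀ α : ℝ, ¬ IsDyadic α → ¬ IsTuringComplete α → ∀ P, Enumerates U P α →
      {n | C U (initSeg α n) < CNat U n + (2 * P.length + c)}.Infinite := by
  obtain ⟨d, hd⟩ := hU.exists_C_le_add hU.partrec_haltingClockMachine
  refine ⟨d + 1, fun α hdyadic hcomplete P ⟨q, hq, hqα⟩ => ?_⟩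
  obtain ⟨s₀, μ, hμ⟩ := hqα.exists_initSeg_eq_iff_le hdyadic
  have hA : Computable₂ fun s n => initSeg ((ratOfNat (q s) : ℚ) : ℝ) n :=
    primrec_initSeg_ratOfNat.to_comp.comp ((hU.computable_of_program hq).comp Computable.fst)
      Computable.snd
  have hhalting : ¬ Nat.RecursiveIn {oracle α} haltingChar := mt RecursiveIn.iff_nat.2 hcomplete
  refine (infinite_settled_at_haltingTime hhalting
    (recursiveIn_oracle α) hA hμ).mono ?_
  rintro n ⟨s, hs, hn⟩
  obtain ⟨Q, hQ, hQn⟩ := hU.exists_minimal_program (strOfNat n)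
  have hC := hd _ _ _ (mem_haltingClockMachine hQn hs (hq s))
  rw [hn, ← initSeg_eq_firstValues, List.length_append, hQ, ← CNat] at hC
  exact (Nat.lt_succ_of_le hC).trans_le (by omega)

end Programs

end LeftCE

open LeftCE in
theorem mainTheorem5_general (U : BinStr → BinStr →. BinStr) (hU : IsUniversalOptimal U) :
    ∃ D : ℕ → ℕ, Computable D ∧ ∀ α : ℝ,
      (¬ IsComputableReal α → ∀ k, ∃ n, CNat U n + k < C U (initSeg α n)) ∧
      (IsLeftCE α → ∃ P, Enumerates U P α) ∧
      (¬ IsDyadic α → ¬ IsTuringComplete α → ∀ P, Enumerates U P α →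
        {n | C U (initSeg α n) < CNat U n + D P.length}.Infinite) := by
  obtain ⟨c, hc⟩ := hU.exists_infinite_C_initSeg_lt
  have hD : Computable fun l => 2 * l + c :=
    (Primrec.nat_add.comp Primrec.nat_double (Primrec.const c)).to_comp
  refine ⟨_, hD, fun α => ⟨fun hα k => ?_, hU.exists_enumerates, hc α⟩⟩
  by_contra! hC
  exact hα (hU.computable_of_C_firstValues_le hC)

theorem mainTheorem5 (U : LeftCE.BinStr → LeftCE.BinStr →. LeftCE.BinStr)
    (hU : LeftCE.IsUniversalOptimal U) :
    ∃ D : ℕ → ℕ, Computable D ∧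
      ∀ α : ℝ, LeftCE.IsLeftCE α → ¬ LeftCE.IsComputableReal α → ¬ LeftCE.IsTuringComplete α →
        (∀ k : ℕ, ∃ n : ℕ, LeftCE.CNat U n + k < LeftCE.C U (LeftCE.initSeg α n)) ∧
        (∃ P : LeftCE.BinStr, LeftCE.Enumerates U P α) ∧
        (∀ P : LeftCE.BinStr, LeftCE.Enumerates U P α →
          {n : ℕ | LeftCE.C U (LeftCE.initSeg α n) < LeftCE.CNat U n + D P.length}.Infinite) := by
  obtain ⟨D, hD, h⟩ := mainTheorem5_general U hU
  exact ⟨D, hD, fun α hce hcomp hturing => ⟨(h α).1 hcomp, (h α).2.1 hce,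
    (h α).2.2 (mt LeftCE.IsDyadic.isComputableReal hcomp) hturing⟩⟩
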